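/- Let $\Sigma$ be a many-sorted first-order signature (non-empty set of sorts $\mathcal S_\Sigma$, function and predicate symbols with arities, equality on every sort). It is countable and its sorts and symbols are coded injectively by natural numbers, so that formulas are finite strings over a coded alphabet and one can speak of computable functions on the set $\mathrm{QF}(\Sigma)$ of quantifier-free formulas. Interpretations consist of non-empty domains $\sigma^{\mathcal A}$ for the sorts $\sigma$, meanings of the symbols, and values of the variables (countably many of each sort). A theory $\mathcal T$ is the class of all interpretations (the $\mathcal T$-interpretations) satisfying a given set of sentences; "$\mathcal T$-satisfiable" means satisfied by some $\mathcal T$-interpretation, and two formulas are $\mathcal T$-equivalent if they are satisfied by the same $\mathcal T$-interpretations. For a formula $\psi$, $\mathrm{vars}(\psi)$ is the set of its free variables, $\mathrm{vars}_\sigma(\psi)$ the set of those of sort $\sigma$, and $\mathrm{vars}_\sigma(\psi)^{\mathcal A}$ the set of their values in $\mathcal A$. Let $S\subseteq\mathcal S_\Sigma$. With respect to $S$, the theory $\mathcal T$ * is *smooth* if for every $\varphi\in\mathrm{QF}(\Sigma)$, every $\mathcal T$-interpretation $\mathcal A\vDash\varphi$ and every function $\kappa$ from $S$ to the cardinals with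 $\kappa(\sigma)\ge|\sigma^{\mathcal A}|$ for all $\sigma\in S$, there is a $\mathcal T$-interpretation $\mathcal B\vDash\varphi$ with $|\sigma^{\mathcal B}|=\kappa(\sigma)$ for all $\sigma\in S$; * is *stably finite* if for every $\varphi\in\mathrm{QF}(\Sigma)$ and $\mathcal T$-interpretation $\mathcal A\vDash\varphi$ there is a $\mathcal T$-interpretation $\mathcal B\vDash\varphi$ with $|\sigma^{\mathcal B}|<\aleph_0$ and $|\sigma^{\mathcal B}|\le|\sigma^{\mathcal A}|$ for all $\sigma\in S$; * has the *minimal model function* $\mathsf{MM}$, a total function on $\mathrm{QF}(\Sigma)$ whose values are sets of functions from $S$ to the cardinals, if for every $\mathcal T$-satisfiable $\varphi\in\mathrm{QF}(\Sigma)$: (i) every $\mathbf n\in\mathsf{MM}(\varphi)$ is $\sigma\mapsto|\sigma^{\mathcal A}|$ for some $\mathcal T$-interpretation $\mathcal A\vDash\varphi$; (ii) for distinct $\mathbf m,\mathbf n\in\mathsf{MM}(\varphi)$ there is $\sigma\in S$ with $\mathbf m(\sigma)<\mathbf n(\sigma)$; (iii) for every $\mathcal T$-interpretation $\mathcal A\vDash\varphi$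 there is $\mathbf n\in\mathsf{MM}(\varphi)$ with $\mathbf n(\sigma)\le|\sigma^{\mathcal A}|$ for all $\sigma\in S$. It is *computable* if from $\varphi$ one can compute $\mathsf{MM}(\varphi)$ as a finite list of functions $S\to\mathbb N\cup\{\aleph_0\}$; * is *shiny* if it is smooth, stably finite and has a computable minimal model function; * has the *witness* $\mathit{wit}:\mathrm{QF}(\Sigma)\to\mathrm{QF}(\Sigma)$, a computable function, if for every $\varphi\in\mathrm{QF}(\Sigma)$: $\varphi$ and $\exists\vec x\,\mathit{wit}(\varphi)$ are $\mathcal T$-equivalent, where $\vec x=\mathrm{vars}(\mathit{wit}(\varphi))\setminus\mathrm{vars}(\varphi)$; and if $\mathit{wit}(\varphi)$ is $\mathcal T$-satisfiable, there is a $\mathcal T$-interpretation $\mathcal A\vDash\varphi$ with $\sigma^{\mathcal A}=\mathrm{vars}_\sigma(\mathit{wit}(\varphi))^{\mathcal A}$ for all $\sigma\in S$; * has the *strong witness* $\mathit{wit}$ if $\mathit{wit}$ is a witness and, for every $\varphi\in\mathrm{QF}(\Sigma)$, every finite set $V$ of variables with sorts in $S$ and every equivalence relation $E$ on $V$ relating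 only variables of equal sort, with arrangement $\delta_V$ (the conjunction of the literals $x=y$ for $x\mathrel{E}y$ and $\neg(x=y)$ for $x,y\in V$ of equal sort that are not $E$-related): if $\mathit{wit}(\varphi)\wedge\delta_V$ is $\mathcal T$-satisfiable, there is a $\mathcal T$-interpretation $\mathcal A\vDash\mathit{wit}(\varphi)\wedge\delta_V$ with $\sigma^{\mathcal A}=\mathrm{vars}_\sigma(\mathit{wit}(\varphi)\wedge\delta_V)^{\mathcal A}$ for all $\sigma\in S$; * is *polite* (respectively *strongly polite*) if it is smooth and has a witness (respectively a strong witness); * is a *Unicorn 3.0 theory* if it is polite and shiny but not strongly polite. **Theorem.** If a theory $\mathcal T$ over $\Sigma$ is shiny with respect to a finite set of sorts $S$, then it is strongly polite with respect to $S$. Moreover, there are no Unicorn 3.0 theories over $\Sigma$, with respect to any set of sorts. -/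

import Mathlib

universe u v

namespace ManySorted

/-- A many-sorted signature. Equality on every sort is built into the formulas below, so `Rel`
lists the predicate symbols other than the equalities. -/
structure Signature where
  Srt : Type v
  Func : Type v
  Rel : Type v
  dom : Func → List Srt
  cod : Func → Srt
  ar : Rel → List Srt
  nonempty_srt : Nonempty Srt

/-- Variables: countably many of each sort; the first component is the sort. -/
abbrev Var (Sig : Signature.{v}) : Type v := Sig.Srt × ℕ

/-- (Well-sorted) terms. -/
inductive Term (Sig : Signature.{v}) : Sig.Srt → Type v
  | var (x : Var Sig) : Term Sig x.1
  | app (f : Sig.Func) (args : ∀ i : Fin (Sig.dom f).length, Term Sig ((Sig.dom f).get i)) :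
      Term Sig (Sig.cod f)

/-- First-order formulas. -/
inductive Formula (Sig : Signature.{v}) : Type v
  | tru : Formula Sig
  | eq (σ : Sig.Srt) (s t : Term Sig σ) : Formula Sig
  | rel (P : Sig.Rel) (args : ∀ i : Fin (Sig.ar P).length, Term Sig ((Sig.ar P).get i)) :
      Formula Sig
  | neg (φ : Formula Sig) : Formula Sig
  | and (φ ψ : Formula Sig) : Formula Sig
  | or (φ ψ : Formula Sig) : Formula Sig
  | all (x : Var Sig) (φ : Formula Sig) : Formula Sig
  | ex (x : Var Sig) (φ : Formula Sig) : Formula Sig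

open Classical in
/-- The variables of a term. -/
noncomputable def Term.vars {Sig : Signature.{v}} : {σ : Sig.Srt} → Term Sig σ → Finset (Var Sig)
  | _, .var x => {x}
  | _, .app _ args => Finset.univ.biUnion fun i => (args i).vars

namespace Formula

variable {Sig : Signature.{v}}

open Classical in
/-- The free variables of a formula. -/
noncomputable def vars : Formula Sig → Finset (Var Sig)
  | tru => ∅
  | eq _ s t => s.vars ∪ t.vars
  | rel _ args => Finset.univ.biUnion fun i => (args i).vars
  | neg φ => φ.vars
  | and φ ψ => φ.vars ∪ ψ.vars
  | or φ ψ => φ.vars ∪ ψ.vars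
  | all x φ => φ.vars.erase x
  | ex x φ => φ.vars.erase x

/-- Quantifier-free formulas. -/
def IsQF : Formula Sig → Prop
  | tru => True
  | eq _ _ _ => True
  | rel _ _ => True
  | neg φ => φ.IsQF
  | and φ ψ => φ.IsQF ∧ ψ.IsQF
  | or φ ψ => φ.IsQF ∧ ψ.IsQF
  | all _ _ => False
  | ex _ _ => False

/-- `∃ x₁ … xₖ, φ`, where `V = {x₁, …, xₖ}`. -/
noncomputable def exs (V : Finset (Var Sig)) (φ : Formula Sig) : Formula Sig :=
  V.toList.foldr ex φ

/-- Conjunction of a finite list of formulas. -/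
def conj (l : List (Formula Sig)) : Formula Sig := l.foldr and tru

open Classical in
/-- The literal contributed to the arrangement by the pair `(x, y)`: `x = y` if `x E y`, and
`¬ (x = y)` otherwise. There is no such literal (trivial conjunct) if the sorts differ. -/
noncomputable def arrLit {V : Finset (Var Sig)} (E : Setoid V) (x y : V) : Formula Sig :=
  if h : y.1.1 = x.1.1 then
    if E x y then eq x.1.1 (.var x.1) (h ▸ .var y.1)
    else neg (eq x.1.1 (.var x.1) (h ▸ .var y.1))
  else tru

/-- The arrangement on `V` induced by the equivalence relation `E`. -/
noncomputable def arrangement (V : Finset (Var Sig)) (E : Setoid V) : Formula Sig :=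
  conj (((Finset.univ : Finset (V × V)).toList).map fun p => arrLit E p.1 p.2)

end Formula

/-- The type of quantifier-free formulas. -/
abbrev QF (Sig : Signature.{v}) : Type v := {φ : Formula Sig // φ.IsQF}

/-! ### Semantics -/

/-- Interpretations: structures with nonempty domains, together with values of the variables. -/
structure Interp (Sig : Signature.{v}) where
  carrier : Sig.Srt → Type u
  nonempty_carrier : ∀ σ, Nonempty (carrier σ)
  func : ∀ f : Sig.Func,
    (∀ i : Fin (Sig.dom f).length, carrier ((Sig.dom f).get i)) → carrier (Sig.cod f)
  rel : ∀ P : Sig.Rel, (∀ i : Fin (Sig.ar P).length, carrier ((Sig.ar P).get i)) → Prop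
  val : ∀ x : Var Sig, carrier x.1

namespace Interp

variable {Sig : Signature.{v}}

open Classical in
/-- The interpretation that agrees with `A` except that the variable `x` has the value `a`. -/
noncomputable def update (A : Interp.{u} Sig) (x : Var Sig) (a : A.carrier x.1) :
    Interp.{u} Sig :=
  { A with val := Function.update A.val x a }

/-- The value of a term. -/
def eval (A : Interp.{u} Sig) : {σ : Sig.Srt} → Term Sig σ → A.carrier σ
  | _, .var x => A.val x
  | _, .app f args => A.func f fun i => A.eval (args i)

end Interp

/-- Satisfaction. -/
def Formula.Sat {Sig : Signature.{v}} : Formula Sig → Interp.{u} Sig → Prop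
  | .tru, _ => True
  | .eq _ s t, A => A.eval s = A.eval t
  | .rel P args, A => A.rel P fun i => A.eval (args i)
  | .neg φ, A => ¬ φ.Sat A
  | .and φ ψ, A => φ.Sat A ∧ ψ.Sat A
  | .or φ ψ, A => φ.Sat A ∨ ψ.Sat A
  | .all x φ, A => ∀ a : A.carrier x.1, φ.Sat (A.update x a)
  | .ex x φ, A => ∃ a : A.carrier x.1, φ.Sat (A.update x a)

/-- `A` satisfies `σ^A = vars_σ(φ)^A` for every sort `σ ∈ S`. -/
def Interp.NamedBy {Sig : Signature.{v}} (A : Interp.{u} Sig) (S : Set Sig.Srt)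
    (φ : Formula Sig) : Prop :=
  ∀ σ ∈ S, (Set.univ : Set (A.carrier σ)) = {a | ∃ i : ℕ, (σ, i) ∈ φ.vars ∧ A.val (σ, i) = a}

/-- A theory is given by its axiomatization, a set of sentences. -/
structure Theory (Sig : Signature.{v}) where
  ax : Set (Formula Sig)
  closed : ∀ φ ∈ ax, φ.vars = ∅

/-! ### Computability

A formula is written, in Polish (prefix) notation, as a string of tokens. A token is a triple
(kind of token, code of the sort or symbol, index of the variable). -/

abbrev Token : Type := ℕ × ℕ × ℕ

section Strings

variable {Sig : Signature.{v}} [Encodable Sig.Srt] [Encodable Sig.Func] [Encodable Sig.Rel]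

/-- The string of a term. -/
def Term.str : {σ : Sig.Srt} → Term Sig σ → List Token
  | _, .var x => [(0, Encodable.encode x.1, x.2)]
  | _, .app f args => (1, Encodable.encode f, 0) :: (List.ofFn fun i => (args i).str).flatten

/-- The string of a formula. -/
def Formula.str : Formula Sig → List Token
  | .rel P args => (2, Encodable.encode P, 0) :: (List.ofFn fun i => (args i).str).flatten
  | .eq σ s t => (3, Encodable.encode σ, 0) :: (s.str ++ t.str)
  | .tru => [(4, 0, 0)]
  | .neg φ => (5, 0, 0) :: φ.str
  | .and φ ψ => (6, 0, 0) :: (φ.str ++ ψ.str)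
  | .or φ ψ => (7, 0, 0) :: (φ.str ++ ψ.str)
  | .all x φ => (8, Encodable.encode x.1, x.2) :: φ.str
  | .ex x φ => (9, Encodable.encode x.1, x.2) :: φ.str

/-- `w` is a computable function from quantifier-free formulas to quantifier-free formulas. -/
def ComputableQF (w : QF Sig → QF Sig) : Prop :=
  ∃ g : List Token → List Token, Computable g ∧ ∀ φ : QF Sig, g φ.1.str = (w φ).1.str

/-- A cardinal in `ℕ ∪ {ℵ₀}` written as a finite object; `none` stands for `ℵ₀`. -/
def toCard : Option ℕ → Cardinal.{u}
  | none => Cardinal.aleph0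
  | some n => (n : Cardinal.{u})

/-- A function that maps quantifier-free formulas to sets of functions from `S` to the cardinals
is computable: from (the string of) `φ` one can compute the number `N` of entries of a finite
list `n₀, …, n_{N-1}` of functions `S → ℕ ∪ {ℵ₀}` whose set of members is `M φ`, and one can
compute the value `nᵢ(σ)` from `φ`, `i` and (the code of) `σ`. -/
def ComputableCards {S : Set Sig.Srt} (M : QF Sig → Set (S → Cardinal.{u})) : Prop :=
  ∃ (N : List Token → ℕ) (c : List Token → ℕ → ℕ → Option ℕ),
    Computable N ∧
    Computable (fun p : List Token × ℕ × ℕ => c p.1 p.2.1 p.2.2) ∧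
    ∀ φ : QF Sig, M φ = {n | ∃ i < N φ.1.str,
      ∀ σ : S, n σ = toCard (c φ.1.str i (Encodable.encode (σ : Sig.Srt)))}

end Strings

/-! ### Theory combination properties -/

namespace Theory

variable {Sig : Signature.{v}}

/-- `A` is a `T`-interpretation. -/
def IsModel (T : Theory Sig) (A : Interp.{u} Sig) : Prop := ∀ φ ∈ T.ax, φ.Sat A

/-- `φ` is `T`-satisfiable. -/
def Satisfiable (T : Theory Sig) (φ : Formula Sig) : Prop :=
  ∃ A : Interp.{u} Sig, T.IsModel A ∧ φ.Sat A

/-- `φ` and `ψ` are `T`-equivalent. -/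
def Equivalent (T : Theory Sig) (φ ψ : Formula Sig) : Prop :=
  ∀ A : Interp.{u} Sig, T.IsModel A → (φ.Sat A ↔ ψ.Sat A)

/-- Smoothness with respect to `S`. -/
def Smooth (T : Theory Sig) (S : Set Sig.Srt) : Prop :=
  ∀ (φ : QF Sig) (A : Interp.{u} Sig), T.IsModel A → φ.1.Sat A →
    ∀ κ : S → Cardinal.{u}, (∀ σ : S, Cardinal.mk (A.carrier σ) ≤ κ σ) →
      ∃ B : Interp.{u} Sig, T.IsModel B ∧ φ.1.Sat B ∧
        ∀ σ : S, Cardinal.mk (B.carrier σ) = κ σ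

/-- Stable finiteness with respect to `S`. -/
def StablyFinite (T : Theory Sig) (S : Set Sig.Srt) : Prop :=
  ∀ (φ : QF Sig) (A : Interp.{u} Sig), T.IsModel A → φ.1.Sat A →
    ∃ B : Interp.{u} Sig, T.IsModel B ∧ φ.1.Sat B ∧
      ∀ σ ∈ S, Cardinal.mk (B.carrier σ) < Cardinal.aleph0 ∧
        Cardinal.mk (B.carrier σ) ≤ Cardinal.mk (A.carrier σ)

/-- `M` is a minimal model function for `T` with respect to `S`. -/
def IsMinimalModelFunction (T : Theory Sig) (S : Set Sig.Srt)
    (M : QF Sig → Set (S → Cardinal.{u})) : Prop :=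
  ∀ φ : QF Sig, Satisfiable.{u} T φ.1 →
    (∀ n ∈ M φ, ∃ A : Interp.{u} Sig, T.IsModel A ∧ φ.1.Sat A ∧
      ∀ σ : S, n σ = Cardinal.mk (A.carrier σ)) ∧
    (∀ m ∈ M φ, ∀ n ∈ M φ, m ≠ n → ∃ σ : S, m σ < n σ) ∧
    (∀ A : Interp.{u} Sig, T.IsModel A → φ.1.Sat A →
      ∃ n ∈ M φ, ∀ σ : S, n σ ≤ Cardinal.mk (A.carrier σ))

variable [Encodable Sig.Srt] [Encodable Sig.Func] [Encodable Sig.Rel]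

open Classical in
/-- `wit` is a witness for `T` with respect to `S`. -/
def IsWitness (T : Theory Sig) (S : Set Sig.Srt) (wit : QF Sig → QF Sig) : Prop :=
  ComputableQF wit ∧
  ∀ φ : QF Sig,
    Equivalent.{u} T φ.1 (Formula.exs ((wit φ).1.vars \ φ.1.vars) (wit φ).1) ∧
    (Satisfiable.{u} T (wit φ).1 →
      ∃ A : Interp.{u} Sig, T.IsModel A ∧ φ.1.Sat A ∧ A.NamedBy S (wit φ).1)

/-- `wit` is a strong witness for `T` with respect to `S`. -/
def IsStrongWitness (T : Theory Sig) (S : Set Sig.Srt) (wit : QF Sig → QF Sig) : Prop :=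
  IsWitness.{u} T S wit ∧
  ∀ (φ : QF Sig) (V : Finset (Var Sig)) (E : Setoid V),
    (∀ x ∈ V, x.1 ∈ S) → (∀ x y : V, E x y → x.1.1 = y.1.1) →
    Satisfiable.{u} T ((wit φ).1.and (Formula.arrangement V E)) →
    ∃ A : Interp.{u} Sig, T.IsModel A ∧ ((wit φ).1.and (Formula.arrangement V E)).Sat A ∧
      A.NamedBy S ((wit φ).1.and (Formula.arrangement V E))

def FinitelyWitnessable (T : Theory Sig) (S : Set Sig.Srt) : Prop :=
  ∃ wit : QF Sig → QF Sig, IsWitness.{u} T S wit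

def StronglyFinitelyWitnessable (T : Theory Sig) (S : Set Sig.Srt) : Prop :=
  ∃ wit : QF Sig → QF Sig, IsStrongWitness.{u} T S wit

def Polite (T : Theory Sig) (S : Set Sig.Srt) : Prop :=
  Smooth.{u} T S ∧ FinitelyWitnessable.{u} T S

def StronglyPolite (T : Theory Sig) (S : Set Sig.Srt) : Prop :=
  Smooth.{u} T S ∧ StronglyFinitelyWitnessable.{u} T S

def Shiny (T : Theory Sig) (S : Set Sig.Srt) : Prop :=
  Smooth.{u} T S ∧ StablyFinite.{u} T S ∧
    ∃ M : QF Sig → Set (S → Cardinal.{u}), IsMinimalModelFunction.{u} T S M ∧ ComputableCards M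

/-- Unicorn 3.0 theories with respect to `S`. -/
def Unicorn3 (T : Theory Sig) (S : Set Sig.Srt) : Prop :=
  Polite.{u} T S ∧ Shiny.{u} T S ∧ ¬ StronglyPolite.{u} T S

end Theory

end ManySorted

/-!
Write `MM` for the minimal model function. Stable finiteness makes all values of `MM` finite, so the
disjunction of the formulas

  `φ ∧ δ ∧ ⋀ σ ∈ S, (n σ many fresh variables of sort σ are distinct)`,

over all arrangements `δ` of the variables of `φ` and all `n ∈ MM (φ ∧ δ)`, is a quantifier-free
formula computable from `φ`. It is a strong witness. Suppose that it holds in `A`, together with an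
arrangement of further variables. At least `n σ` elements of each sort `σ ∈ S` are then values of
variables, so by smoothness the model of `φ ∧ δ` of size `n` grows to one that has exactly as many
elements as there are values in `A`. Since `δ` already decides the equalities between the variables
of `φ`, the other variables can be revalued there to name every element with the same equalities as
in `A`.

A witness of `⊤` names all elements of the sorts in `S` by finitely many variables, and domains are
nonempty, so a polite theory that has a model is polite with respect to finitely many sorts only.
-/

namespace ManySorted

section Cardinality

theorem exists_equiv_apply_eq {ι X Y : Type*} [Finite X] (e₀ : X ≃ Y) {g : ι → X} {h : ι → Y}
    (hgh : ∀ i j, g i = g j ↔ h i = h j) : ∃ e : X ≃ Y, ∀ i, e (g i) = h i := by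
  classical
  have := Fintype.ofFinite X
  have := Fintype.ofEquiv X e₀
  have hext (i : ι) : Function.extend g h e₀ (g i) = h i :=
    Function.FactorsThrough.extend_apply (fun i j => (hgh i j).1) e₀ i
  have hinj : Set.InjOn (Function.extend g h e₀) (Set.range g) := by
    rintro _ ⟨i, rfl⟩ _ ⟨j, rfl⟩ hij
    rwa [hext, hext, ← hgh] at hij
  obtain ⟨e, he⟩ := Set.MapsTo.exists_equiv_extend_of_card_eq (t := Finset.univ)
    (by simpa using Fintype.card_congr e₀) (fun _ _ => by simp) hinj
  exact ⟨e.trans (Equiv.subtypeUnivEquiv Finset.mem_univ), fun i => (he _ ⟨i, rfl⟩).trans (hext i)⟩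

theorem natCast_le_mk_iff {α : Type u} {n : ℕ} :
    (n : Cardinal) ≤ Cardinal.mk α ↔ Nonempty (Fin n ↪ α) := by
  simpa using Cardinal.lift_mk_le' (α := Fin n) (β := α)

theorem natCast_le_mk_of_injOn {α : Type u} {s : Set α} {f : ℕ → α} {n : ℕ}
    (hf : Set.InjOn f (Set.Iio n)) (hs : Set.MapsTo f (Set.Iio n) s) :
    (n : Cardinal) ≤ Cardinal.mk s :=
  natCast_le_mk_iff.2 ⟨fun j => ⟨f j, hs j.2⟩, fun j k hjk =>
    Fin.ext (hf j.2 k.2 (Subtype.ext_iff.1 hjk))⟩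

theorem exists_injOn_Iio_of_natCast_le_mk {α : Type u} [Nonempty α] {n : ℕ}
    (h : (n : Cardinal) ≤ Cardinal.mk α) : ∃ f : ℕ → α, Set.InjOn f (Set.Iio n) := by
  obtain ⟨e⟩ := natCast_le_mk_iff.1 h
  refine ⟨Function.extend Fin.val e fun _ => Classical.arbitrary α, fun j hj k hk hjk => ?_⟩
  lift j to Fin n using hj
  lift k to Fin n using hk
  rw [Fin.val_injective.extend_apply, Fin.val_injective.extend_apply] at hjk
  rw [e.injective hjk]

theorem toCard_eq_natCast_getD {o : Option ℕ} (ho : toCard.{u} o < Cardinal.aleph0) :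
    toCard.{u} o = (o.getD 0 : ℕ) := by
  cases o with
  | none => exact absurd ho (lt_irrefl _)
  | some n => rfl

end Cardinality

variable {Sig : Signature.{v}}

/-! ### Semantics -/

/-- The interpretation that agrees with `A` except that the variables have the values `w`. -/
def Interp.withVal (A : Interp.{u} Sig) (w : ∀ x : Var Sig, A.carrier x.1) : Interp.{u} Sig :=
  { A with val := w }

theorem Interp.eval_withVal {A : Interp.{u} Sig} {w : ∀ x : Var Sig, A.carrier x.1} {σ : Sig.Srt}
    {t : Term Sig σ} (h : ∀ x ∈ t.vars, w x = A.val x) : (A.withVal w).eval t = A.eval t := by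
  induction t with
  | var x => exact h x (Finset.mem_singleton_self x)
  | app f args ih =>
    simp only [Term.vars, Finset.mem_biUnion, Finset.mem_univ, true_and, forall_exists_index] at h
    exact congrArg (A.func f) (funext fun i => ih i fun x => h x i)

theorem Interp.val_update_withVal {A : Interp.{u} Sig} {w : ∀ x : Var Sig, A.carrier x.1}
    {x : Var Sig} {a : A.carrier x.1} {V : Finset (Var Sig)}
    (h : ∀ y ∈ V, y ≠ x → w y = A.val y) :
    ∀ y ∈ V, ((A.withVal w).update x a).val y = (A.update x a).val y := by
  classical
  intro y hy
  obtain rfl | hyx := eq_or_ne y x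
  · simp only [update, withVal, Function.update_self]
  · simp only [update, withVal, Function.update_of_ne hyx, h y hy hyx]

theorem Formula.sat_withVal {A : Interp.{u} Sig} {w : ∀ x : Var Sig, A.carrier x.1}
    {φ : Formula Sig} (h : ∀ x ∈ φ.vars, w x = A.val x) : φ.Sat (A.withVal w) ↔ φ.Sat A := by
  induction φ generalizing A with
  | tru => exact Iff.rfl
  | eq σ s t =>
    simp only [vars, Finset.mem_union, or_imp, forall_and] at h
    simp only [Sat, Interp.eval_withVal h.1, Interp.eval_withVal h.2]
    exact Iff.rfl
  | rel P args =>
    simp only [vars, Finset.mem_biUnion, Finset.mem_univ, true_and, forall_exists_index] at h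
    exact iff_of_eq (congrArg (A.rel P) (funext fun i => Interp.eval_withVal fun x => h x i))
  | neg φ ih => exact not_congr (ih h)
  | and φ ψ ihφ ihψ =>
    simp only [vars, Finset.mem_union, or_imp, forall_and] at h
    exact and_congr (ihφ h.1) (ihψ h.2)
  | or φ ψ ihφ ihψ =>
    simp only [vars, Finset.mem_union, or_imp, forall_and] at h
    exact or_congr (ihφ h.1) (ihψ h.2)
  | all x φ ih =>
    exact forall_congr' fun a => ih (A := A.update x a) <| Interp.val_update_withVal
      fun y hy hyx => h y (by simp [vars, hyx, hy])
  | ex x φ ih =>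
    exact exists_congr fun a => ih (A := A.update x a) <| Interp.val_update_withVal
      fun y hy hyx => h y (by simp [vars, hyx, hy])

theorem Theory.IsModel.withVal {T : Theory Sig} {A : Interp.{u} Sig} (hA : T.IsModel A)
    (w : ∀ x : Var Sig, A.carrier x.1) : T.IsModel (A.withVal w) := fun φ hφ =>
  (Formula.sat_withVal fun x hx => absurd hx (by simp [T.closed φ hφ])).2 (hA φ hφ)

theorem Formula.sat_foldr_ex {l : List (Var Sig)} {φ : Formula Sig} {A : Interp.{u} Sig} :
    (l.foldr ex φ).Sat A ↔
      ∃ w : ∀ x : Var Sig, A.carrier x.1, (∀ x ∉ l, w x = A.val x) ∧ φ.Sat (A.withVal w) := by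
  classical
  induction l generalizing A with
  | nil =>
    refine ⟨fun h => ⟨A.val, fun _ _ => rfl, h⟩, ?_⟩
    rintro ⟨w, hw, h⟩
    exact (sat_withVal fun x _ => hw x List.not_mem_nil).1 h
  | cons x l ih =>
    refine (exists_congr fun a => ih (A := A.update x a)).trans ⟨?_, ?_⟩
    · rintro ⟨a, w, hw, h⟩
      refine ⟨w, fun y hy => ?_, h⟩
      rw [List.mem_cons, not_or] at hy
      exact (hw y hy.2).trans (Function.update_of_ne hy.1 _ _)
    · rintro ⟨w, hw, h⟩
      refine ⟨w x, w, fun y hy => ?_, h⟩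
      obtain rfl | hyx := eq_or_ne y x
      · exact (Function.update_self (f := A.val) _ _).symm
      · exact (hw y (by simp [hyx, hy])).trans (Function.update_of_ne hyx _ _).symm

theorem Formula.sat_exs_vars_sdiff [DecidableEq (Var Sig)] {V : Finset (Var Sig)}
    {φ : Formula Sig} {A : Interp.{u} Sig} :
    (exs (φ.vars \ V) φ).Sat A ↔
      ∃ w : ∀ x : Var Sig, A.carrier x.1, (∀ x ∈ V, w x = A.val x) ∧ φ.Sat (A.withVal w) := by
  simp only [exs, sat_foldr_ex, Finset.mem_toList, Finset.mem_sdiff, not_and_or, not_not]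
  constructor
  · rintro ⟨w, hw, h⟩
    exact ⟨w, fun x hx => hw x (Or.inr hx), h⟩
  · rintro ⟨w, hw, h⟩
    refine ⟨fun x => if x ∈ φ.vars then w x else A.val x, ?_, ?_⟩
    · rintro x (hx | hx)
      · exact if_neg hx
      · simp only [hw x hx, ite_self]
    · exact (sat_withVal (A := A.withVal w) fun x hx => if_pos hx).2 h

section Connectives

theorem Formula.sat_conj {l : List (Formula Sig)} {A : Interp.{u} Sig} :
    (conj l).Sat A ↔ ∀ φ ∈ l, φ.Sat A := by
  induction l with
  | nil => simp [conj, Sat]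
  | cons φ l ih =>
    rw [List.forall_mem_cons, ← ih]
    exact Iff.rfl

theorem Formula.mem_vars_conj {l : List (Formula Sig)} {x : Var Sig} :
    x ∈ (conj l).vars ↔ ∃ φ ∈ l, x ∈ φ.vars := by
  classical
  induction l with
  | nil => simp [conj, vars]
  | cons φ l ih =>
    simp only [List.mem_cons, exists_eq_or_imp, ← ih]
    exact Finset.mem_union

theorem Formula.isQF_conj {l : List (Formula Sig)} (h : ∀ φ ∈ l, φ.IsQF) : (conj l).IsQF := by
  induction l with
  | nil => trivial
  | cons φ l ih => exact ⟨h φ List.mem_cons_self, ih fun ψ hψ => h ψ (List.mem_cons_of_mem φ hψ)⟩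

/-- Disjunction of a finite list of formulas. -/
def Formula.disj (l : List (Formula Sig)) : Formula Sig := l.foldr or tru.neg

theorem Formula.sat_disj {l : List (Formula Sig)} {A : Interp.{u} Sig} :
    (disj l).Sat A ↔ ∃ φ ∈ l, φ.Sat A := by
  induction l with
  | nil => simp [disj, Sat]
  | cons φ l ih =>
    simp only [List.mem_cons, exists_eq_or_imp, ← ih]
    exact Iff.rfl

theorem Formula.mem_vars_disj {l : List (Formula Sig)} {x : Var Sig} :
    x ∈ (disj l).vars ↔ ∃ φ ∈ l, x ∈ φ.vars := by
  classical
  induction l with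
  | nil => simp [disj, vars]
  | cons φ l ih =>
    simp only [List.mem_cons, exists_eq_or_imp, ← ih]
    exact Finset.mem_union

theorem Formula.isQF_disj {l : List (Formula Sig)} (h : ∀ φ ∈ l, φ.IsQF) : (disj l).IsQF := by
  induction l with
  | nil => trivial
  | cons φ l ih => exact ⟨h φ List.mem_cons_self, ih fun ψ hψ => h ψ (List.mem_cons_of_mem φ hψ)⟩

/-- The equation between the `i`-th and the `j`-th variable of sort `σ`. -/
def Formula.varEq (σ : Sig.Srt) (i j : ℕ) : Formula Sig := eq σ (.var (σ, i)) (.var (σ, j))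

theorem Formula.sat_varEq {σ : Sig.Srt} {i j : ℕ} {A : Interp.{u} Sig} :
    (varEq σ i j).Sat A ↔ A.val (σ, i) = A.val (σ, j) := by
  simp only [varEq, Sat, Interp.eval]

theorem Formula.mem_vars_varEq {σ : Sig.Srt} {i j : ℕ} {x : Var Sig} :
    x ∈ (varEq σ i j).vars ↔ x = (σ, i) ∨ x = (σ, j) := by
  simp [varEq, vars, Term.vars]

end Connectives

section Arrangements

/-- `A` and `B` satisfy the same equations between variables in `V`, so they induce the same
arrangement of `V`. -/
def Interp.SameArrangement (A B : Interp.{u} Sig) (V : Set (Var Sig)) : Prop :=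
  ∀ ⦃σ i j⦄, (σ, i) ∈ V → (σ, j) ∈ V →
    (A.val (σ, i) = A.val (σ, j) ↔ B.val (σ, i) = B.val (σ, j))

theorem Interp.SameArrangement.mono {A B : Interp.{u} Sig} {V W : Set (Var Sig)}
    (h : A.SameArrangement B W) (hVW : V ⊆ W) : A.SameArrangement B V :=
  fun _ _ _ hi hj => h (hVW hi) (hVW hj)

theorem Formula.sat_arrLit_congr {V : Finset (Var Sig)} {E : Setoid V} {x y : V}
    {A B : Interp.{u} Sig} (h : A.SameArrangement B V) :
    (arrLit E x y).Sat A ↔ (arrLit E x y).Sat B := by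
  obtain ⟨⟨σ, i⟩, hi⟩ := x
  obtain ⟨⟨τ, j⟩, hj⟩ := y
  by_cases hτ : τ = σ
  · subst hτ
    rw [arrLit, dif_pos rfl]
    split_ifs
    exacts [h hi hj, not_congr (h hi hj)]
  · rw [arrLit, dif_neg hτ]
    exact Iff.rfl

theorem Formula.sat_arrangement_congr {V : Finset (Var Sig)} {E : Setoid V}
    {A B : Interp.{u} Sig} (h : A.SameArrangement B V) :
    (arrangement V E).Sat A ↔ (arrangement V E).Sat B := by
  simp only [arrangement, sat_conj, List.forall_mem_map, sat_arrLit_congr h]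

theorem Formula.subset_vars_arrangement (V : Finset (Var Sig)) (E : Setoid V) :
    V ⊆ (arrangement V E).vars := by
  intro x hx
  refine mem_vars_conj.2
    ⟨_, List.mem_map.2 ⟨(⟨x, hx⟩, ⟨x, hx⟩), Finset.mem_toList.2 (Finset.mem_univ _), rfl⟩, ?_⟩
  rw [arrLit, dif_pos rfl]
  split_ifs <;> simp [vars, Term.vars]

end Arrangements

section Smooth

variable {T : Theory Sig} {S : Set Sig.Srt}

/-- The values in `A` of the variables in `V` of sort `σ`. -/
def Interp.valuesOf (A : Interp.{u} Sig) (V : Finset (Var Sig)) (σ : Sig.Srt) :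
    Set (A.carrier σ) := (fun i => A.val (σ, i)) '' {i | (σ, i) ∈ V}

theorem Interp.val_mem_valuesOf (A : Interp.{u} Sig) {V : Finset (Var Sig)} {σ : Sig.Srt} {i : ℕ}
    (hi : (σ, i) ∈ V) : A.val (σ, i) ∈ A.valuesOf V σ :=
  ⟨i, hi, rfl⟩

theorem Interp.finite_valuesOf (A : Interp.{u} Sig) (V : Finset (Var Sig)) (σ : Sig.Srt) :
    (A.valuesOf V σ).Finite :=
  (V.finite_toSet.preimage (Prod.mk_right_injective σ).injOn).image _

theorem Interp.namedBy_iff {A : Interp.{u} Sig} {φ : Formula Sig} :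
    A.NamedBy S φ ↔ ∀ σ ∈ S, A.valuesOf φ.vars σ = Set.univ :=
  forall₂_congr fun _ _ => eq_comm

theorem Interp.exists_withVal_namedBy {A C : Interp.{u} Sig} {V : Finset (Var Sig)}
    {χ : Formula Sig} (hV : A.SameArrangement C V)
    (hcard : ∀ σ ∈ S, Cardinal.mk (A.valuesOf χ.vars σ) = Cardinal.mk (C.carrier σ)) :
    ∃ w : ∀ x : Var Sig, C.carrier x.1, (∀ x ∈ V, w x = C.val x) ∧
      A.SameArrangement (C.withVal w) {x | x ∈ χ.vars ∧ x.1 ∈ S} ∧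
      (C.withVal w).NamedBy S χ := by
  classical
  have exists_equiv : ∀ σ ∈ S, ∃ e : A.valuesOf χ.vars σ ≃ C.carrier σ,
      ∀ i (hi : (σ, i) ∈ χ.vars), (σ, i) ∈ V → e ⟨_, A.val_mem_valuesOf hi⟩ = C.val (σ, i) := by
    intro σ hσ
    have := (A.finite_valuesOf χ.vars σ).to_subtype
    obtain ⟨e₀⟩ := Cardinal.eq.1 (hcard σ hσ)
    obtain ⟨e, he⟩ := exists_equiv_apply_eq e₀
      (g := fun i : {i // (σ, i) ∈ χ.vars ∧ (σ, i) ∈ V} => ⟨_, A.val_mem_valuesOf i.2.1⟩)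
      (h := fun i => C.val (σ, i)) fun i j => Subtype.ext_iff.trans (hV i.2.2 j.2.2)
    exact ⟨e, fun i hi hiV => he ⟨i, hi, hiV⟩⟩
  choose e he using exists_equiv
  let w (x : Var Sig) : C.carrier x.1 :=
    if h : x ∈ χ.vars ∧ x.1 ∈ S then e x.1 h.2 ⟨_, A.val_mem_valuesOf h.1⟩ else C.val x
  have w_apply {σ : Sig.Srt} {i : ℕ} (hi : (σ, i) ∈ χ.vars) (hσ : σ ∈ S) :
      w (σ, i) = e σ hσ ⟨_, A.val_mem_valuesOf hi⟩ := dif_pos ⟨hi, hσ⟩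
  refine ⟨w, fun x hx => ?_, fun σ i j hi hj => ?_, namedBy_iff.2 fun σ hσ => ?_⟩
  · by_cases h : x ∈ χ.vars ∧ x.1 ∈ S
    · exact (w_apply h.1 h.2).trans (he x.1 h.2 x.2 h.1 hx)
    · exact dif_neg h
  · change _ ↔ w (σ, i) = w (σ, j)
    rw [w_apply hi.1 hi.2, w_apply hj.1 hj.2, (e σ _).injective.eq_iff, Subtype.ext_iff]
  · refine Set.eq_univ_of_forall fun a => ?_
    obtain ⟨⟨_, i, hi, rfl⟩, rfl⟩ := (e σ hσ).surjective a
    exact ⟨i, hi, w_apply hi hσ⟩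

theorem Theory.Smooth.exists_namedBy (hT : Smooth.{u} T S) {ψ : QF Sig} {χ : Formula Sig}
    {A B : Interp.{u} Sig} (hB : T.IsModel B) (hψB : ψ.1.Sat B)
    (hψ : ∀ C : Interp.{u} Sig, ψ.1.Sat C → A.SameArrangement C ψ.1.vars)
    (hcard : ∀ σ ∈ S, Cardinal.mk (B.carrier σ) ≤ Cardinal.mk (A.valuesOf χ.vars σ)) :
    ∃ C : Interp.{u} Sig, T.IsModel C ∧ ψ.1.Sat C ∧
      A.SameArrangement C {x | x ∈ χ.vars ∧ x.1 ∈ S} ∧ C.NamedBy S χ := by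
  obtain ⟨C, hC, hψC, hcardC⟩ := hT ψ B hB hψB (fun σ => Cardinal.mk (A.valuesOf χ.vars σ))
    fun σ => hcard σ σ.2
  obtain ⟨w, hw, harr, hnamed⟩ := Interp.exists_withVal_namedBy (χ := χ) (hψ C hψC)
    fun σ hσ => (hcardC ⟨σ, hσ⟩).symm
  exact ⟨C.withVal w, hC.withVal w, (Formula.sat_withVal hw).2 hψC, harr, hnamed⟩

end Smooth

/-! ### The witness -/

section Splits

/-- The conjunctions of `φ` with, for every formula in `θs`, this formula or its negation. -/
def Formula.splits (θs : List (Formula Sig)) (φ : Formula Sig) : List (Formula Sig) :=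
  θs.foldr (fun θ ψs => ψs.flatMap fun ψ => [ψ.and θ, ψ.and θ.neg]) [φ]

variable {θ φ ψ χ : Formula Sig} {θs : List (Formula Sig)} {A B : Interp.{u} Sig}

theorem Formula.mem_splits_nil : ψ ∈ splits [] φ ↔ ψ = φ :=
  List.mem_singleton

theorem Formula.mem_splits_cons :
    χ ∈ splits (θ :: θs) φ ↔ ∃ ψ ∈ splits θs φ, χ = ψ.and θ ∨ χ = ψ.and θ.neg := by
  simp [splits]

theorem Formula.isQF_of_mem_splits (hθs : ∀ θ ∈ θs, θ.IsQF) (hφ : φ.IsQF)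
    (hψ : ψ ∈ splits θs φ) : ψ.IsQF := by
  induction θs generalizing ψ with
  | nil => rwa [mem_splits_nil.1 hψ]
  | cons θ θs ih =>
    rw [List.forall_mem_cons] at hθs
    obtain ⟨χ, hχ, rfl | rfl⟩ := mem_splits_cons.1 hψ <;> exact ⟨ih hθs.2 hχ, hθs.1⟩

theorem Formula.vars_eq_of_mem_splits (hθs : ∀ θ ∈ θs, θ.vars ⊆ φ.vars)
    (hψ : ψ ∈ splits θs φ) : ψ.vars = φ.vars := by
  classical
  induction θs generalizing ψ with
  | nil => rw [mem_splits_nil.1 hψ]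
  | cons θ θs ih =>
    rw [List.forall_mem_cons] at hθs
    obtain ⟨χ, hχ, rfl | rfl⟩ := mem_splits_cons.1 hψ <;>
      simpa [vars, ih hθs.2 hχ] using hθs.1

theorem Formula.sat_of_mem_splits (hψ : ψ ∈ splits θs φ) (hψA : ψ.Sat A) : φ.Sat A := by
  induction θs generalizing ψ with
  | nil => rwa [← mem_splits_nil.1 hψ]
  | cons θ θs ih =>
    obtain ⟨χ, hχ, rfl | rfl⟩ := mem_splits_cons.1 hψ <;> exact ih hχ hψA.1

theorem Formula.exists_mem_splits_sat (θs : List (Formula Sig)) (hφA : φ.Sat A) :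
    ∃ ψ ∈ splits θs φ, ψ.Sat A := by
  induction θs with
  | nil => exact ⟨φ, mem_splits_nil.2 rfl, hφA⟩
  | cons θ θs ih =>
    obtain ⟨ψ, hψ, hψA⟩ := ih
    by_cases hθA : θ.Sat A
    · exact ⟨_, mem_splits_cons.2 ⟨ψ, hψ, Or.inl rfl⟩, hψA, hθA⟩
    · exact ⟨_, mem_splits_cons.2 ⟨ψ, hψ, Or.inr rfl⟩, hψA, hθA⟩

theorem Formula.sat_iff_of_mem_splits (hψ : ψ ∈ splits θs φ) (hψA : ψ.Sat A) (hψB : ψ.Sat B)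
    (hθ : θ ∈ θs) : θ.Sat A ↔ θ.Sat B := by
  induction θs generalizing ψ with
  | nil => exact absurd hθ List.not_mem_nil
  | cons θ' θs ih =>
    obtain ⟨χ, hχ, h⟩ := mem_splits_cons.1 hψ
    obtain rfl | hθ := List.mem_cons.1 hθ
    · obtain rfl | rfl := h
      exacts [iff_of_true hψA.2 hψB.2, iff_of_false hψA.2 hψB.2]
    · obtain rfl | rfl := h <;> exact ih hχ hψA.1 hψB.1 hθ

end Splits

section Occurrences

/-- The variables of a term in the order of their occurrences, from left to right. Unlike
`Term.vars`, this list can be computed from the string of the term. -/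
def Term.occ : {σ : Sig.Srt} → Term Sig σ → List (Var Sig)
  | _, .var x => [x]
  | _, .app _ args => (List.ofFn fun i => (args i).occ).flatten

/-- The variables in the terms of a formula, bound or free, in the order of their occurrences. -/
def Formula.occ : Formula Sig → List (Var Sig)
  | tru => []
  | eq _ s t => s.occ ++ t.occ
  | rel _ args => (List.ofFn fun i => (args i).occ).flatten
  | neg φ => φ.occ
  | and φ ψ => φ.occ ++ ψ.occ
  | or φ ψ => φ.occ ++ ψ.occ
  | all _ φ => φ.occ
  | ex _ φ => φ.occ

theorem Term.mem_occ {σ : Sig.Srt} {t : Term Sig σ} {x : Var Sig} : x ∈ t.occ ↔ x ∈ t.vars := by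
  induction t with
  | var y => simp [occ, vars]
  | app f args ih => simp [occ, vars, List.mem_ofFn, ih]

theorem Formula.mem_occ {φ : Formula Sig} (hφ : φ.IsQF) {x : Var Sig} :
    x ∈ φ.occ ↔ x ∈ φ.vars := by
  induction φ with
  | tru => simp [occ, vars]
  | eq σ s t => simp [occ, vars, Term.mem_occ]
  | rel P args => simp [occ, vars, List.mem_ofFn, Term.mem_occ]
  | neg φ ih => exact ih hφ
  | and φ ψ ihφ ihψ => simp [occ, vars, ihφ hφ.1, ihψ hφ.2]
  | or φ ψ ihφ ihψ => simp [occ, vars, ihφ hφ.1, ihψ hφ.2]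
  | all => exact hφ.elim
  | ex => exact hφ.elim

/-- A strict upper bound for the indices of the variables that occur in `φ`. -/
def Formula.freshIndex (φ : Formula Sig) : ℕ := φ.occ.foldr (fun x m => max (x.2 + 1) m) 0

theorem Formula.lt_freshIndex {φ : Formula Sig} (hφ : φ.IsQF) {x : Var Sig} (hx : x ∈ φ.vars) :
    x.2 < φ.freshIndex := by
  have lt_foldr (l : List (Var Sig)) (hx : x ∈ l) :
      x.2 < l.foldr (fun x m => max (x.2 + 1) m) 0 := by
    induction l with
    | nil => exact absurd hx List.not_mem_nil
    | cons y l ih =>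
      rw [List.foldr_cons, lt_max_iff]
      obtain rfl | hx := List.mem_cons.1 hx
      exacts [Or.inl (Nat.lt_succ_self _), Or.inr (ih hx)]
  exact lt_foldr _ ((mem_occ hφ).2 hx)

open Classical in
/-- The equations between two variables of equal sort that occur in `φ`. -/
noncomputable def Formula.varEqs (φ : Formula Sig) : List (Formula Sig) :=
  φ.occ.flatMap fun x => φ.occ.flatMap fun y => if x.1 = y.1 then [varEq x.1 x.2 y.2] else []

theorem Formula.mem_varEqs {φ θ : Formula Sig} (hφ : φ.IsQF) :
    θ ∈ φ.varEqs ↔ ∃ σ i j, (σ, i) ∈ φ.vars ∧ (σ, j) ∈ φ.vars ∧ θ = varEq σ i j := by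
  simp only [varEqs, List.mem_flatMap, mem_occ hφ]
  constructor
  · rintro ⟨⟨σ, i⟩, hi, ⟨τ, j⟩, hj, hθ⟩
    split_ifs at hθ with h
    · obtain rfl : σ = τ := h
      exact ⟨σ, i, j, hi, hj, List.mem_singleton.1 hθ⟩
    · exact absurd hθ List.not_mem_nil
  · rintro ⟨σ, i, j, hi, hj, rfl⟩
    exact ⟨(σ, i), hi, (σ, j), hj, by simp⟩

/-- The conjunctions of `φ` with the arrangements of its variables, including inconsistent ones. -/
noncomputable def Formula.eqSplits (φ : Formula Sig) : List (Formula Sig) := splits φ.varEqs φ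

variable {φ ψ : Formula Sig} {A B : Interp.{u} Sig}

theorem Formula.isQF_of_mem_eqSplits (hφ : φ.IsQF) (hψ : ψ ∈ φ.eqSplits) : ψ.IsQF := by
  refine isQF_of_mem_splits (fun θ hθ => ?_) hφ hψ
  obtain ⟨σ, i, j, -, -, rfl⟩ := (mem_varEqs hφ).1 hθ
  trivial

theorem Formula.vars_eq_of_mem_eqSplits (hφ : φ.IsQF) (hψ : ψ ∈ φ.eqSplits) :
    ψ.vars = φ.vars := by
  refine vars_eq_of_mem_splits (fun θ hθ x hx => ?_) hψ
  obtain ⟨σ, i, j, hi, hj, rfl⟩ := (mem_varEqs hφ).1 hθ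
  obtain rfl | rfl := mem_vars_varEq.1 hx
  exacts [hi, hj]

theorem Formula.sameArrangement_of_mem_eqSplits (hφ : φ.IsQF) (hψ : ψ ∈ φ.eqSplits)
    (hψA : ψ.Sat A) (hψB : ψ.Sat B) : A.SameArrangement B ψ.vars := by
  rw [vars_eq_of_mem_eqSplits hφ hψ]
  intro σ i j hi hj
  rw [← sat_varEq, ← sat_varEq]
  exact sat_iff_of_mem_splits hψ hψA hψB ((mem_varEqs hφ).2 ⟨σ, i, j, hi, hj, rfl⟩)

end Occurrences

section Distinct

/-- The literals saying that the `n` variables of sort `σ` from the `m`-th one on are distinct,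
together with the trivial equations `x = x`, which make these variables occur even if `n = 1`. -/
def Formula.distinctLits (σ : Sig.Srt) (m n : ℕ) : List (Formula Sig) :=
  (List.range n).flatMap fun j => (List.range n).map fun k =>
    if j = k then varEq σ (m + j) (m + k) else (varEq σ (m + j) (m + k)).neg

/-- The formula saying, for every `σ ∈ s`, that the `n σ` variables of sort `σ` from the `m`-th one
on are distinct. -/
noncomputable def Formula.distinct (s : Finset Sig.Srt) (m : ℕ) (n : Sig.Srt → ℕ) : Formula Sig :=
  conj (s.toList.flatMap fun σ => distinctLits σ m (n σ))

variable {s : Finset Sig.Srt} {m : ℕ} {n : Sig.Srt → ℕ}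

theorem Formula.mem_distinctLits {σ : Sig.Srt} {m n : ℕ} {φ : Formula Sig} :
    φ ∈ distinctLits σ m n ↔ ∃ j < n, ∃ k < n,
      (if j = k then varEq σ (m + j) (m + k) else (varEq σ (m + j) (m + k)).neg) = φ := by
  simp only [distinctLits, List.mem_flatMap, List.mem_map, List.mem_range]

theorem Formula.isQF_distinct (s : Finset Sig.Srt) (m : ℕ) (n : Sig.Srt → ℕ) :
    (distinct s m n).IsQF := by
  refine isQF_conj fun φ hφ => ?_
  simp only [List.mem_flatMap, mem_distinctLits] at hφ
  obtain ⟨σ, -, j, -, k, -, rfl⟩ := hφ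
  split_ifs <;> trivial

theorem Formula.sat_distinct {A : Interp.{u} Sig} :
    (distinct s m n).Sat A ↔
      ∀ σ ∈ s, Set.InjOn (fun j => A.val (σ, m + j)) (Set.Iio (n σ)) := by
  have sat_lit (σ : Sig.Srt) (j k : ℕ) :
      (if j = k then varEq σ (m + j) (m + k) else (varEq σ (m + j) (m + k)).neg).Sat A ↔
        (A.val (σ, m + j) = A.val (σ, m + k) → j = k) := by
    split_ifs with hjk
    · simp [sat_varEq, hjk]
    · simp [Sat, sat_varEq, hjk]
  simp only [distinct, sat_conj, List.forall_mem_flatMap, Finset.mem_toList, distinctLits,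
    List.forall_mem_map, List.mem_range, sat_lit]
  exact forall₂_congr fun _ _ => ⟨fun h j hj k hk => h j hj k hk, fun h j hj k hk => h hj hk⟩

theorem Formula.mem_vars_distinct {σ : Sig.Srt} (hσ : σ ∈ s) {j : ℕ} (hj : j < n σ) :
    (σ, m + j) ∈ (distinct s m n).vars :=
  mem_vars_conj.2 ⟨varEq σ (m + j) (m + j), List.mem_flatMap.2 ⟨σ, Finset.mem_toList.2 hσ,
    mem_distinctLits.2 ⟨j, hj, j, hj, if_pos rfl⟩⟩, mem_vars_varEq.2 (Or.inl rfl)⟩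

end Distinct

section Witness

/-- Every formula `φ` has a finite list `sizes φ` of tuples of natural numbers that are sizes of
`T`-models of `φ`, at least one of which bounds the size of any given `T`-model of `φ` from below.
The lists given by the minimal model function of a shiny theory are like this. -/
structure Theory.IsSizeBasis (T : Theory Sig) (S : Set Sig.Srt)
    (sizes : Formula Sig → List (Sig.Srt → ℕ)) : Prop where
  exists_model : ∀ φ : QF Sig, Satisfiable.{u} T φ.1 → ∀ n ∈ sizes φ.1,
    ∃ B : Interp.{u} Sig, T.IsModel B ∧ φ.1.Sat B ∧ ∀ σ ∈ S, Cardinal.mk (B.carrier σ) = n σ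
  exists_le : ∀ (φ : QF Sig) (A : Interp.{u} Sig), T.IsModel A → φ.1.Sat A →
    ∃ n ∈ sizes φ.1, ∀ σ ∈ S, (n σ : Cardinal) ≤ Cardinal.mk (A.carrier σ)

/-- The disjunction of the formulas `φ ∧ δ ∧ (n σ fresh variables of each sort σ ∈ s are distinct)`
over the arrangements `δ` of the variables of `φ` and the tuples `n` in `sizes (φ ∧ δ)`. -/
noncomputable def Formula.witness (s : Finset Sig.Srt) (sizes : Formula Sig → List (Sig.Srt → ℕ))
    (φ : Formula Sig) : Formula Sig :=
  disj (φ.eqSplits.flatMap fun ψ => (sizes ψ).map fun n => ψ.and (distinct s φ.freshIndex n))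

variable {s : Finset Sig.Srt} {sizes : Formula Sig → List (Sig.Srt → ℕ)}

theorem Formula.isQF_witness {φ : Formula Sig} (hφ : φ.IsQF) : (φ.witness s sizes).IsQF := by
  refine isQF_disj fun χ hχ => ?_
  simp only [List.mem_flatMap, List.mem_map] at hχ
  obtain ⟨ψ, hψ, n, -, rfl⟩ := hχ
  exact ⟨isQF_of_mem_eqSplits hφ hψ, isQF_distinct _ _ _⟩

theorem Formula.sat_witness {φ : Formula Sig} {A : Interp.{u} Sig} :
    (φ.witness s sizes).Sat A ↔ ∃ ψ ∈ φ.eqSplits, ψ.Sat A ∧ ∃ n ∈ sizes ψ,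
      ∀ σ ∈ s, Set.InjOn (fun j => A.val (σ, φ.freshIndex + j)) (Set.Iio (n σ)) := by
  rw [witness, sat_disj]
  constructor
  · intro ⟨χ, hχ, hχA⟩
    simp only [List.mem_flatMap, List.mem_map] at hχ
    obtain ⟨ψ, hψ, n, hn, rfl⟩ := hχ
    exact ⟨ψ, hψ, hχA.1, n, hn, sat_distinct.1 hχA.2⟩
  · intro ⟨ψ, hψ, hψA, n, hn, hinj⟩
    exact ⟨_, List.mem_flatMap.2 ⟨ψ, hψ, List.mem_map_of_mem hn⟩, hψA, sat_distinct.2 hinj⟩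

theorem Formula.sat_of_sat_witness {φ : Formula Sig} {A : Interp.{u} Sig}
    (h : (φ.witness s sizes).Sat A) : φ.Sat A := by
  obtain ⟨ψ, hψ, hψA, -⟩ := sat_witness.1 h
  exact sat_of_mem_splits hψ hψA

theorem Formula.mem_vars_witness {φ ψ : Formula Sig} (hψ : ψ ∈ φ.eqSplits) {n : Sig.Srt → ℕ}
    (hn : n ∈ sizes ψ) {σ : Sig.Srt} (hσ : σ ∈ s) {j : ℕ} (hj : j < n σ) :
    (σ, φ.freshIndex + j) ∈ (φ.witness s sizes).vars := by
  classical
  exact mem_vars_disj.2 ⟨_, List.mem_flatMap.2 ⟨ψ, hψ, List.mem_map_of_mem hn⟩,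
    Finset.mem_union_right _ (mem_vars_distinct hσ hj)⟩

variable {T : Theory Sig} {φ : QF Sig} {A : Interp.{u} Sig}

theorem Theory.IsSizeBasis.exists_namedBy (hsizes : IsSizeBasis.{u} T s sizes)
    (hsm : Smooth.{u} T s) (hA : T.IsModel A) (hφA : (φ.1.witness s sizes).Sat A)
    {χ : Formula Sig} (hχ : (φ.1.witness s sizes).vars ⊆ χ.vars) :
    ∃ C : Interp.{u} Sig, T.IsModel C ∧ (φ.1.witness s sizes).Sat C ∧
      A.SameArrangement C {x | x ∈ χ.vars ∧ x.1 ∈ (s : Set Sig.Srt)} ∧ C.NamedBy s χ := by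
  obtain ⟨ψ, hψ, hψA, n, hn, hinj⟩ := Formula.sat_witness.1 hφA
  have hψQF := Formula.isQF_of_mem_eqSplits φ.2 hψ
  have fresh_mem {σ} (hσ : σ ∈ s) {j} (hj : j < n σ) : (σ, φ.1.freshIndex + j) ∈ χ.vars :=
    hχ (Formula.mem_vars_witness hψ hn hσ hj)
  obtain ⟨B, hB, hψB, hcard⟩ := hsizes.exists_model ⟨ψ, hψQF⟩ ⟨A, hA, hψA⟩ n hn
  obtain ⟨C, hC, hψC, harr, hnamed⟩ := hsm.exists_namedBy (ψ := ⟨ψ, hψQF⟩) (χ := χ) hB hψB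
    (fun C => Formula.sameArrangement_of_mem_eqSplits φ.2 hψ hψA) fun σ hσ =>
      (hcard σ hσ).trans_le (natCast_le_mk_of_injOn (hinj σ hσ)
        fun j hj => A.val_mem_valuesOf (fresh_mem hσ hj))
  refine ⟨C, hC, Formula.sat_witness.2 ⟨ψ, hψ, hψC, n, hn, fun σ hσ j hj k hk hjk => ?_⟩, harr,
    hnamed⟩
  exact hinj σ hσ hj hk ((harr ⟨fresh_mem hσ hj, hσ⟩ ⟨fresh_mem hσ hk, hσ⟩).2 hjk)

theorem Theory.IsSizeBasis.exists_withVal_sat_witness (hsizes : IsSizeBasis.{u} T s sizes)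
    (hA : T.IsModel A) (hφA : φ.1.Sat A) :
    ∃ w : ∀ x : Var Sig, A.carrier x.1, (∀ x ∈ φ.1.vars, w x = A.val x) ∧
      (φ.1.witness s sizes).Sat (A.withVal w) := by
  classical
  obtain ⟨ψ, hψ, hψA⟩ := Formula.exists_mem_splits_sat φ.1.varEqs hφA
  obtain ⟨n, hn, hnA⟩ := hsizes.exists_le ⟨ψ, Formula.isQF_of_mem_eqSplits φ.2 hψ⟩ A hA hψA
  have exists_injOn (σ : Sig.Srt) :
      ∃ g : ℕ → A.carrier σ, σ ∈ s → Set.InjOn g (Set.Iio (n σ)) := by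
    have := A.nonempty_carrier σ
    by_cases hσ : σ ∈ s
    · obtain ⟨g, hg⟩ := exists_injOn_Iio_of_natCast_le_mk (hnA σ hσ)
      exact ⟨g, fun _ => hg⟩
    · exact ⟨fun _ => Classical.arbitrary _, fun h => absurd h hσ⟩
  choose g hg using exists_injOn
  let w (x : Var Sig) : A.carrier x.1 :=
    if x.2 < φ.1.freshIndex then A.val x else g x.1 (x.2 - φ.1.freshIndex)
  have w_old : ∀ x ∈ φ.1.vars, w x = A.val x := fun x hx => if_pos (Formula.lt_freshIndex φ.2 hx)
  have w_fresh (σ : Sig.Srt) (j : ℕ) : w (σ, φ.1.freshIndex + j) = g σ j := by simp [w]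
  refine ⟨w, w_old, Formula.sat_witness.2 ⟨ψ, hψ, ?_, n, hn, fun σ hσ => ?_⟩⟩
  · rw [Formula.sat_withVal fun x hx => w_old x (Formula.vars_eq_of_mem_eqSplits φ.2 hψ ▸ hx)]
    exact hψA
  · exact (hg σ hσ).congr fun j _ => (w_fresh σ j).symm

open Classical in
theorem Theory.IsSizeBasis.equivalent_exs_witness (hsizes : IsSizeBasis.{u} T s sizes) :
    Equivalent.{u} T φ.1 (Formula.exs ((φ.1.witness s sizes).vars \ φ.1.vars)
      (φ.1.witness s sizes)) := fun A hA => by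
  rw [Formula.sat_exs_vars_sdiff]
  refine ⟨hsizes.exists_withVal_sat_witness hA, fun ⟨w, hw, h⟩ => ?_⟩
  exact (Formula.sat_withVal hw).1 (Formula.sat_of_sat_witness h)

end Witness

/-! ### Computability of the witness -/

section Computability

attribute [local fun_prop] Computable

variable {α β γ : Type*} [Primcodable α] [Primcodable β] [Primcodable γ]

/-! The closure properties of `Computable`, restated in the form in which `fun_prop` can apply
them. -/

theorem computable_id : Computable fun a : α => a :=
  Computable.id

theorem computable_const (b : β) : Computable fun _ : α => b :=
  Computable.const b

theorem computable_comp {g : β → γ} {f : α → β} (hg : Computable g) (hf : Computable f) :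
    Computable fun a => g (f a) :=
  hg.comp hf

theorem computable_fst {f : α → β × γ} (hf : Computable f) : Computable fun a => (f a).1 :=
  Computable.fst.comp hf

theorem computable_snd {f : α → β × γ} (hf : Computable f) : Computable fun a => (f a).2 :=
  Computable.snd.comp hf

theorem computable_pair {f : α → β} {g : α → γ} (hf : Computable f) (hg : Computable g) :
    Computable fun a => (f a, g a) :=
  hf.pair hg

attribute [local fun_prop] computable_id computable_const computable_comp computable_fst
  computable_snd computable_pair

theorem computable_add {f g : α → ℕ} (hf : Computable f) (hg : Computable g) :
    Computable fun a => f a + g a :=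
  Primrec.nat_add.to_comp.comp hf hg

theorem computable_max {f g : α → ℕ} (hf : Computable f) (hg : Computable g) :
    Computable fun a => max (f a) (g a) :=
  Primrec.nat_max.to_comp.comp hf hg

theorem computable_ite_eq {f g : α → ℕ} {h k : α → β} (hf : Computable f) (hg : Computable g)
    (hh : Computable h) (hk : Computable k) :
    Computable fun a => if f a = g a then h a else k a :=
  (Computable.cond (Primrec.beq.to_comp.comp hf hg) hh hk).of_eq fun a => by
    simp only [Bool.cond_eq_ite, beq_iff_eq]

theorem computable_cons {f : α → β} {g : α → List β} (hf : Computable f) (hg : Computable g) :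
    Computable fun a => f a :: g a :=
  Computable.list_cons.comp hf hg

theorem computable_append {f g : α → List β} (hf : Computable f) (hg : Computable g) :
    Computable fun a => f a ++ g a :=
  Computable.list_append.comp hf hg

theorem computable_range {f : α → ℕ} (hf : Computable f) : Computable fun a => List.range (f a) :=
  Primrec.list_range.to_comp.comp hf

attribute [local fun_prop] computable_add computable_max computable_ite_eq computable_cons
  computable_append computable_range

theorem computable_foldl {f : α → List β} {g : α → γ} {h : α → γ → β → γ} (hf : Computable f)
    (hg : Computable g) (hh : Computable fun p : α × γ × β => h p.1 p.2.1 p.2.2) :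
    Computable fun a => (f a).foldl (h a) (g a) := by
  have h_step : Computable fun q : (α × ℕ × γ) × β => h q.1.1 q.1.2.2 q.2 :=
    hh.comp (g := fun q : (α × ℕ × γ) × β => (q.1.1, q.1.2.2, q.2)) (by fun_prop)
  have h_get : Computable fun q : α × ℕ × γ => (f q.1)[q.2.1]? :=
    Computable.list_getElem?.comp (by fun_prop) (by fun_prop)
  have h_elim : Computable₂ fun (a : α) (p : ℕ × γ) => ((f a)[p.1]?).elim p.2 (h a p.2) :=
    (Computable.option_casesOn h_get (f := fun q => q.2.2) (by fun_prop) h_step.to₂).of_eq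
      fun q => by
        dsimp only
        cases (f q.1)[q.2.1]? <;> rfl
  refine (Computable.nat_rec (Computable.list_length.comp hf) hg h_elim).of_eq fun a => ?_
  have rec_eq_foldl_take (n : ℕ) :
      Nat.rec (motive := fun _ => γ) (g a) (fun k c => ((f a)[k]?).elim c (h a c)) n =
        ((f a).take n).foldl (h a) (g a) := by
    induction n with
    | zero => rfl
    | succ n ih =>
      simp only [ih, List.take_add_one, List.foldl_append]
      cases (f a)[n]? <;> rfl
  exact (rec_eq_foldl_take _).trans (by rw [List.take_length])

theorem computable_foldr {f : α → List β} {g : α → γ} {h : α → β → γ → γ} (hf : Computable f)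
    (hg : Computable g) (hh : Computable fun p : α × β × γ => h p.1 p.2.1 p.2.2) :
    Computable fun a => (f a).foldr (h a) (g a) :=
  (computable_foldl (h := fun a c b => h a b c) (Computable.list_reverse.comp hf) hg
    (hh.comp (g := fun p : α × γ × β => (p.1, p.2.2, p.2.1)) (by fun_prop))).of_eq fun _ =>
      List.foldl_reverse

attribute [local fun_prop] computable_foldr

theorem computable_flatMap {f : α → List β} {g : α → β → List γ} (hf : Computable f)
    (hg : Computable fun p : α × β => g p.1 p.2) : Computable fun a => (f a).flatMap (g a) := by
  simp only [List.flatMap_eq_foldl]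
  exact computable_foldl hf (by fun_prop) (by fun_prop)

theorem computable_map {f : α → List β} {g : α → β → γ} (hf : Computable f)
    (hg : Computable fun p : α × β => g p.1 p.2) : Computable fun a => (f a).map (g a) :=
  (computable_flatMap (g := fun a b => [g a b]) hf (by fun_prop)).of_eq fun _ =>
    List.map_eq_flatMap.symm

attribute [local fun_prop] computable_flatMap computable_map

/-- The string of the equation between the `i`-th and the `j`-th variable of the sort with code
`a`. -/
def eqStr (a i j : ℕ) : List Token := [(3, a, 0), (0, a, i), (0, a, j)]

/-- The string of the negation of the formula with string `s`. -/
def negStr (s : List Token) : List Token := (5, 0, 0) :: s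

/-- The string of the conjunction of the formulas with strings `s` and `t`. -/
def andStr (s t : List Token) : List Token := (6, 0, 0) :: (s ++ t)

/-- The string of the disjunction of the formulas with strings `s` and `t`. -/
def orStr (s t : List Token) : List Token := (7, 0, 0) :: (s ++ t)

/-- The string of the conjunction of the formulas with strings in `l`. -/
def conjStr (l : List (List Token)) : List Token := l.foldr andStr [(4, 0, 0)]

/-- The string of the disjunction of the formulas with strings in `l`. -/
def disjStr (l : List (List Token)) : List Token := l.foldr orStr (negStr [(4, 0, 0)])

/-- The operation on strings that corresponds to `Formula.splits`. -/
def splitStrs (θs : List (List Token)) (s : List Token) : List (List Token) :=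
  θs.foldr (fun θ ψs => ψs.flatMap fun ψ => [andStr ψ θ, andStr ψ (negStr θ)]) [s]

/-- The tokens for the variables in the terms of a formula, given its string. -/
def varTokens (s : List Token) : List Token := s.filter fun x => x.1 = 0

/-- The operation on strings that corresponds to `Formula.freshIndex`. -/
def freshIndexStr (s : List Token) : ℕ := (varTokens s).foldr (fun x m => max (x.2.2 + 1) m) 0

/-- The operation on strings that corresponds to `Formula.varEqs`. -/
def varEqStrs (s : List Token) : List (List Token) :=
  (varTokens s).flatMap fun x => (varTokens s).flatMap fun y =>
    if x.2.1 = y.2.1 then [eqStr x.2.1 x.2.2 y.2.2] else []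

/-- The operation on strings that corresponds to `Formula.distinctLits`. -/
def distinctLitStrs (a m n : ℕ) : List (List Token) :=
  (List.range n).flatMap fun j => (List.range n).map fun k =>
    if j = k then eqStr a (m + j) (m + k) else negStr (eqStr a (m + j) (m + k))

/-- The operation on strings that corresponds to `Formula.distinct`, for the sorts with codes in
`codes`. -/
def distinctStr (codes : List ℕ) (m : ℕ) (n : ℕ → ℕ) : List Token :=
  conjStr (codes.flatMap fun a => distinctLitStrs a m (n a))

/-- The operation on strings that corresponds to `Formula.witness`, for the sorts with codes in
`codes` and the sizes `Formula.stringSizes N n`. -/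
def witnessStr (codes : List ℕ) (N : List Token → ℕ) (n : List Token → ℕ → ℕ → ℕ)
    (s : List Token) : List Token :=
  disjStr ((splitStrs (varEqStrs s) s).flatMap fun ψ => (List.range (N ψ)).map fun i =>
    andStr ψ (distinctStr codes (freshIndexStr s) (n ψ i)))

theorem computable_varTokens : Computable varTokens :=
  (Primrec.listFilter (Primrec.eq.comp Primrec.fst (Primrec.const 0))).to_comp

attribute [local fun_prop] computable_varTokens

theorem computable_freshIndexStr : Computable freshIndexStr := by
  unfold freshIndexStr
  fun_prop

theorem computable_varEqStrs : Computable varEqStrs := by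
  unfold varEqStrs eqStr
  fun_prop

theorem computable_splitStrs :
    Computable fun p : List (List Token) × List Token => splitStrs p.1 p.2 := by
  unfold splitStrs andStr negStr
  fun_prop

attribute [local fun_prop] computable_freshIndexStr computable_varEqStrs computable_splitStrs

theorem computable_conjStr : Computable conjStr := by
  unfold conjStr andStr
  fun_prop

theorem computable_disjStr : Computable disjStr := by
  unfold disjStr orStr
  fun_prop

theorem computable_distinctLitStrs :
    Computable fun p : ℕ × ℕ × ℕ => distinctLitStrs p.1 p.2.1 p.2.2 := by
  unfold distinctLitStrs negStr eqStr
  fun_prop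

attribute [local fun_prop] computable_conjStr computable_disjStr computable_distinctLitStrs

theorem computable_witnessStr (codes : List ℕ) {N : List Token → ℕ}
    {n : List Token → ℕ → ℕ → ℕ} (hN : Computable N)
    (hn : Computable fun p : List Token × ℕ × ℕ => n p.1 p.2.1 p.2.2) :
    Computable (witnessStr codes N n) := by
  unfold witnessStr distinctStr andStr
  fun_prop

end Computability

section Strings

variable [Encodable Sig.Srt]

theorem Term.varTokens_str [Encodable Sig.Func] {σ : Sig.Srt} (t : Term Sig σ) :
    varTokens t.str = t.occ.map fun x => (0, Encodable.encode x.1, x.2) := by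
  induction t with
  | var x => rfl
  | app f args ih =>
    unfold varTokens at ih ⊢
    simp [str, occ, List.filter_flatten, List.map_flatten, List.map_ofFn, Function.comp_def, ih]

variable [Encodable Sig.Func] [Encodable Sig.Rel]

theorem Formula.varTokens_str (φ : Formula Sig) :
    varTokens φ.str = φ.occ.map fun x => (0, Encodable.encode x.1, x.2) := by
  have filter_str {σ : Sig.Srt} (t : Term Sig σ) := t.varTokens_str
  unfold varTokens at filter_str ⊢
  induction φ <;>
    simp_all [str, occ, List.filter_flatten, List.map_flatten, List.map_ofFn, Function.comp_def]

theorem Formula.freshIndexStr_str (φ : Formula Sig) : freshIndexStr φ.str = φ.freshIndex := by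
  rw [freshIndexStr, varTokens_str, List.foldr_map, freshIndex]

theorem Formula.str_varEq (σ : Sig.Srt) (i j : ℕ) :
    (varEq σ i j).str = eqStr (Encodable.encode σ) i j :=
  rfl

theorem Formula.varEqStrs_str (φ : Formula Sig) : varEqStrs φ.str = φ.varEqs.map str := by
  simp only [varEqStrs, varEqs, varTokens_str, List.flatMap_map, List.map_flatMap,
    apply_ite (List.map str), List.map_singleton, List.map_nil, str_varEq]
  congr!
  exact Encodable.encode_inj

theorem Formula.splitStrs_str (θs : List (Formula Sig)) (φ : Formula Sig) :
    splitStrs (θs.map str) φ.str = (splits θs φ).map str := by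
  induction θs with
  | nil => rfl
  | cons θ θs ih =>
    change (splitStrs (θs.map str) φ.str).flatMap _ = _
    rw [ih, List.flatMap_map]
    exact (List.map_flatMap (f := str)
      (g := fun ψ => [ψ.and θ, ψ.and θ.neg]) (l := splits θs φ)).symm

theorem Formula.str_conj (l : List (Formula Sig)) : (conj l).str = conjStr (l.map str) := by
  rw [conjStr, List.foldr_map]
  exact (List.foldr_hom str fun _ _ => rfl).symm

theorem Formula.str_disj (l : List (Formula Sig)) : (disj l).str = disjStr (l.map str) := by
  rw [disjStr, List.foldr_map]
  exact (List.foldr_hom str fun _ _ => rfl).symm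

theorem Formula.map_str_distinctLits (σ : Sig.Srt) (m n : ℕ) :
    (distinctLits σ m n).map str = distinctLitStrs (Encodable.encode σ) m n := by
  simp only [distinctLits, distinctLitStrs, List.map_flatMap, List.map_map]
  congr! 5
  exact apply_ite str _ _ _

theorem Formula.str_distinct (s : Finset Sig.Srt) (m : ℕ) (n : ℕ → ℕ) :
    (distinct s m fun σ => n (Encodable.encode σ)).str =
      distinctStr (s.toList.map Encodable.encode) m n := by
  simp only [distinct, str_conj, List.map_flatMap, map_str_distinctLits, distinctStr,
    List.flatMap_map]

/-- The tuples of sizes computed from the string of a formula: there are `N` of them, and the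
component of the `i`-th one at the sort with code `a` is `n _ i a`. -/
def Formula.stringSizes (N : List Token → ℕ) (n : List Token → ℕ → ℕ → ℕ) (φ : Formula Sig) :
    List (Sig.Srt → ℕ) :=
  (List.range (N φ.str)).map fun i σ => n φ.str i (Encodable.encode σ)

theorem Formula.str_witness (s : Finset Sig.Srt) (N : List Token → ℕ)
    (n : List Token → ℕ → ℕ → ℕ) (φ : Formula Sig) :
    (φ.witness s (stringSizes N n)).str =
      witnessStr (s.toList.map Encodable.encode) N n φ.str := by
  simp only [witness, str_disj, stringSizes, eqSplits, witnessStr, varEqStrs_str, splitStrs_str,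
    freshIndexStr_str, List.map_flatMap, List.flatMap_map, List.map_map, ← str_distinct]
  rfl

end Strings

/-! ### Shiny theories -/

section Shiny

variable {T : Theory Sig} {S : Set Sig.Srt}

theorem Theory.IsMinimalModelFunction.lt_aleph0 {M : QF Sig → Set (S → Cardinal.{u})}
    (hM : T.IsMinimalModelFunction S M) (hT : StablyFinite.{u} T S) {φ : QF Sig}
    (hφ : Satisfiable.{u} T φ.1) {n : S → Cardinal.{u}} (hn : n ∈ M φ) (σ : S) :
    n σ < Cardinal.aleph0 := by
  obtain ⟨hM_model, hM_antichain, hM_le⟩ := hM φ hφ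
  obtain ⟨A, hA, hφA, hnA⟩ := hM_model n hn
  obtain ⟨B, hB, hφB, hBA⟩ := hT φ A hA hφA
  obtain ⟨m, hm, hmB⟩ := hM_le B hB hφB
  have hmn : m ≤ n := fun τ => (hmB τ).trans ((hBA τ τ.2).2.trans_eq (hnA τ).symm)
  obtain rfl : n = m := by
    by_contra hne
    obtain ⟨τ, hτ⟩ := hM_antichain n hn m hm hne
    exact (hmn τ).not_gt hτ
  exact (hmB σ).trans_lt (hBA σ σ.2).1

variable [Encodable Sig.Srt] [Encodable Sig.Func] [Encodable Sig.Rel]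

theorem Theory.StablyFinite.exists_isSizeBasis (hT : StablyFinite.{u} T S)
    {M : QF Sig → Set (S → Cardinal.{u})} (hM : T.IsMinimalModelFunction S M)
    (hMcomp : ComputableCards M) :
    ∃ (N : List Token → ℕ) (n : List Token → ℕ → ℕ → ℕ), Computable N ∧
      (Computable fun p : List Token × ℕ × ℕ => n p.1 p.2.1 p.2.2) ∧
      IsSizeBasis.{u} T S (Formula.stringSizes N n) := by
  obtain ⟨N, c, hN, hc, hMc⟩ := hMcomp
  let n (w : List Token) (i a : ℕ) : ℕ := (c w i a).getD 0
  have mem_M {φ : QF Sig} (hφ : Satisfiable.{u} T φ.1) {κ : S → Cardinal.{u}} :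
      κ ∈ M φ ↔ ∃ t ∈ φ.1.stringSizes N n, ∀ σ : S, κ σ = t σ := by
    have toCard_eq {i : ℕ} (hi : i < N φ.1.str) (σ : S) :
        toCard.{u} (c φ.1.str i (Encodable.encode σ.1)) = n φ.1.str i (Encodable.encode σ.1) := by
      refine toCard_eq_natCast_getD (hM.lt_aleph0 hT hφ
        (n := fun σ => toCard (c φ.1.str i (Encodable.encode σ.1))) ?_ σ)
      exact hMc φ ▸ ⟨i, hi, fun _ => rfl⟩
    simp only [hMc, Formula.stringSizes, Set.mem_ofPred_eq, List.mem_map, List.mem_range,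
      exists_exists_and_eq_and]
    exact exists_congr fun i => and_congr_right fun hi => by simp only [toCard_eq hi]
  refine ⟨N, n, hN, Computable.option_getD hc (Computable.const 0), ⟨fun φ hφ t ht => ?_, ?_⟩⟩
  · obtain ⟨B, hB, hφB, hcard⟩ := (hM φ hφ).1 (fun σ => t σ) ((mem_M hφ).2 ⟨t, ht, fun _ => rfl⟩)
    exact ⟨B, hB, hφB, fun σ hσ => (hcard ⟨σ, hσ⟩).symm⟩
  · intro φ A hA hφA
    obtain ⟨κ, hκ, hκA⟩ := (hM φ ⟨A, hA, hφA⟩).2.2 A hA hφA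
    obtain ⟨t, ht, hκt⟩ := (mem_M ⟨A, hA, hφA⟩).1 hκ
    exact ⟨t, ht, fun σ hσ => (hκt ⟨σ, hσ⟩).ge.trans (hκA ⟨σ, hσ⟩)⟩

theorem Theory.Shiny.stronglyFinitelyWitnessable (hT : Shiny.{u} T S) (hS : S.Finite) :
    StronglyFinitelyWitnessable.{u} T S := by
  obtain ⟨s, rfl⟩ := hS.exists_finset_coe
  obtain ⟨hsm, hfin, M, hM, hMcomp⟩ := hT
  obtain ⟨N, n, hN, hn, hsizes⟩ := hfin.exists_isSizeBasis hM hMcomp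
  refine ⟨fun φ => ⟨φ.1.witness s (Formula.stringSizes N n), Formula.isQF_witness φ.2⟩,
    ⟨⟨_, computable_witnessStr (s.toList.map Encodable.encode) hN hn,
      fun φ => (φ.1.str_witness s N n).symm⟩, fun φ => ⟨hsizes.equivalent_exs_witness, ?_⟩⟩, ?_⟩
  · rintro ⟨A, hA, hφA⟩
    obtain ⟨C, hC, hφC, -, hnamed⟩ := hsizes.exists_namedBy hsm hA hφA subset_rfl
    exact ⟨C, hC, Formula.sat_of_sat_witness hφC, hnamed⟩
  · classical
    rintro φ V E hVS - ⟨A, hA, hφA, hEA⟩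
    obtain ⟨C, hC, hφC, harr, hnamed⟩ := hsizes.exists_namedBy hsm hA hφA
      (χ := (φ.1.witness s (Formula.stringSizes N n)).and (Formula.arrangement V E))
      Finset.subset_union_left
    have hV : A.SameArrangement C V := harr.mono fun x hx =>
      ⟨Finset.mem_union_right _ (Formula.subset_vars_arrangement V E hx), hVS x hx⟩
    exact ⟨C, hC, ⟨hφC, (Formula.sat_arrangement_congr hV).1 hEA⟩, hnamed⟩

theorem Theory.Shiny.stronglyPolite (hT : Shiny.{u} T S) (hS : S.Finite) :
    StronglyPolite.{u} T S :=
  ⟨hT.1, hT.stronglyFinitelyWitnessable hS⟩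

theorem Theory.FinitelyWitnessable.finite (hT : FinitelyWitnessable.{u} T S) {A : Interp.{u} Sig}
    (hA : T.IsModel A) : S.Finite := by
  classical
  obtain ⟨wit, -, hwit⟩ := hT
  obtain ⟨heq, hsat⟩ := hwit ⟨.tru, trivial⟩
  obtain ⟨w, -, hw⟩ := Formula.sat_exs_vars_sdiff.1 ((heq A hA).1 trivial)
  obtain ⟨B, -, -, hB⟩ := hsat ⟨A.withVal w, hA.withVal w, hw⟩
  refine ((wit ⟨.tru, trivial⟩).1.vars.image Prod.fst).finite_toSet.subset fun σ hσ => ?_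
  obtain ⟨a⟩ := B.nonempty_carrier σ
  obtain ⟨i, hi, -⟩ := (hB σ hσ).le (Set.mem_univ a)
  exact Finset.mem_coe.2 (Finset.mem_image_of_mem Prod.fst hi)

theorem Theory.stronglyPolite_of_forall_not_isModel (hT : ∀ A : Interp.{u} Sig, ¬ T.IsModel A) :
    StronglyPolite.{u} T S := by
  have not_satisfiable (φ : Formula Sig) : ¬ Satisfiable.{u} T φ := fun ⟨A, hA, _⟩ => hT A hA
  exact ⟨fun _ A hA => absurd hA (hT A), id, ⟨⟨id, Computable.id, fun _ => rfl⟩, fun _ =>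
    ⟨fun A hA => absurd hA (hT A), fun h => absurd h (not_satisfiable _)⟩⟩,
    fun _ _ _ _ _ h => absurd h (not_satisfiable _)⟩

theorem Theory.Shiny.stronglyPolite_of_polite (hT : Shiny.{u} T S) (hpol : Polite.{u} T S) :
    StronglyPolite.{u} T S := by
  by_cases hmodel : ∃ A : Interp.{u} Sig, T.IsModel A
  · obtain ⟨A, hA⟩ := hmodel
    exact hT.stronglyPolite (hpol.2.finite hA)
  · exact stronglyPolite_of_forall_not_isModel (not_exists.1 hmodel)

end Shiny

end ManySorted

theorem mainTheorem2 (Sig : ManySorted.Signature.{v})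
    [Encodable Sig.Srt] [Encodable Sig.Func] [Encodable Sig.Rel] :
    (∀ (T : ManySorted.Theory Sig) (S : Set Sig.Srt), S.Finite →
      ManySorted.Theory.Shiny.{u} T S → ManySorted.Theory.StronglyPolite.{u} T S) ∧
    ¬ ∃ (T : ManySorted.Theory Sig) (S : Set Sig.Srt), ManySorted.Theory.Unicorn3.{u} T S :=
  ⟨fun _ _ hS hT => hT.stronglyPolite hS, fun ⟨_, _, hpolite, hshiny, hnot⟩ =>
    hnot (hshiny.stronglyPolite_of_polite hpolite)⟩
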